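/- **Theorem.** Let $H,K$ be complex Hilbert spaces and let $\Delta_H,\Delta_K$ be positive non-degenerate (possibly unbounded) operators on $H$ and $K$ respectively, that is, self-adjoint operators with $\langle \xi, \Delta\xi\rangle\ge 0$ for $\xi\in D(\Delta)$ and $\ker\Delta=\{0\}$. For $z\in\mathbb C$ let $\Delta_H^z$, $\Delta_K^z$ denote the complex powers given by the functional calculus; in particular $(\Delta_H^{it})_{t\in\mathbb R}$ and $(\Delta_K^{it})_{t\in\mathbb R}$ are strongly continuous unitary groups. Let $T:H\to K$ be a bounded linear operator with $T\Delta_H^{it}=\Delta_K^{it}T$ for all $t\in\mathbb R$. Then for every $z\in\mathbb C$ the operator $T\Delta_H^z$, with domain $D(\Delta_H^z)$, is closable, and its closure is the operator $\Delta_K^z T$ with its natural domain $\{\xi\in H : T\xi\in D(\Delta_K^z)\}$. -/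

import Mathlib

open scoped InnerProductSpace

universe u v

namespace UnboundedPower

section Composition

variable {E : Type*} {F : Type*} {G : Type*} [AddCommGroup E] [Module ℂ E]
  [AddCommGroup F] [Module ℂ F] [AddCommGroup G] [Module ℂ G]

/-- The composition `f ∘ T` of a partially defined operator `f` with an everywhere defined
operator `T`, on its natural domain `{x | T x ∈ D(f)}`. (The composition `T ∘ f` in the other
order, with domain `D(f)`, is Mathlib's `LinearMap.compPMap`.) -/
def precomp (f : F →ₗ.[ℂ] G) (T : E →ₗ[ℂ] F) : E →ₗ.[ℂ] G where
  domain := f.domain.comap T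
  toFun := f.toFun ∘ₗ (T.restrict (p := f.domain.comap T) (q := f.domain) fun _ hx => hx)

theorem mem_graph_precomp_iff (f : F →ₗ.[ℂ] G) (T : E →ₗ[ℂ] F) (x : E) (y : G) :
    (x, y) ∈ (precomp f T).graph ↔ (T x, y) ∈ f.graph := by
  simp only [LinearPMap.mem_graph_iff]
  constructor
  · rintro ⟨w, rfl, rfl⟩
    exact ⟨⟨T w, w.2⟩, rfl, rfl⟩
  · rintro ⟨w, hw, rfl⟩
    have hx : T x ∈ f.domain := hw ▸ w.2
    refine ⟨⟨x, hx⟩, rfl, ?_⟩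
    change f ⟨T x, hx⟩ = f w
    congr 1
    exact Subtype.ext hw.symm

end Composition

variable {H : Type*} [NormedAddCommGroup H] [InnerProductSpace ℂ H] [CompleteSpace H]

/-- `A` is a positive non-degenerate, possibly unbounded, operator on `H`: it is self-adjoint
(in particular densely defined), `⟪x, A x⟫ ≥ 0` for `x ∈ D(A)`, and `A` is injective. -/
structure IsPositiveNondegenerate (A : H →ₗ.[ℂ] H) : Prop where
  isSelfAdjoint : IsSelfAdjoint A
  inner_nonneg : ∀ x : A.domain, 0 ≤ (⟪(x : H), A x⟫_ℂ).re
  injective : ∀ x : A.domain, A x = 0 → (x : H) = 0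

namespace IsPositiveNondegenerate

variable {A : H →ₗ.[ℂ] H}

theorem symmetric (hA : IsPositiveNondegenerate A) (x y : A.domain) :
    ⟪A x, (y : H)⟫_ℂ = ⟪(x : H), A y⟫_ℂ := by
  have h := LinearPMap.adjoint_isFormalAdjoint hA.isSelfAdjoint.dense_domain
  rw [show A.adjoint = A from hA.isSelfAdjoint] at h
  exact h x y

theorem norm_sq_le (hA : IsPositiveNondegenerate A) (x : A.domain) :
    ‖(x : H)‖ ^ 2 ≤ (⟪(x : H), A x + x⟫_ℂ).re := by
  have h1 : (⟪(x : H), (x : H)⟫_ℂ).re = ‖(x : H)‖ ^ 2 := inner_self_eq_norm_sq (𝕜 := ℂ) (x : H)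
  rw [inner_add_right, Complex.add_re, h1]
  linarith [hA.inner_nonneg x]

theorem norm_le (hA : IsPositiveNondegenerate A) (x : A.domain) :
    ‖(x : H)‖ ≤ ‖A x + x‖ := by
  have h := (hA.norm_sq_le x).trans
    ((Complex.re_le_norm _).trans (norm_inner_le_norm (x : H) (A x + x)))
  by_contra! hlt
  nlinarith [norm_nonneg (x : H), norm_nonneg (A x + x)]

theorem exists_add_eq (hA : IsPositiveNondegenerate A) (y : H) : ∃ x : A.domain, A x + x = y := by
  let S : A.domain →ₗ[ℂ] H := A.toFun + A.domain.subtype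
  have hclosed : IsClosed (LinearMap.range S : Set H) := by
    refine IsSeqClosed.isClosed ?_
    intro w l hw hl
    choose x hx using hw
    have hdist : ∀ m n, dist ((x m : H)) (x n) ≤ dist (w m) (w n) := by
      intro m n
      rw [dist_eq_norm, dist_eq_norm, ← hx m, ← hx n, ← map_sub]
      exact hA.norm_le (x m - x n)
    have hc : CauchySeq fun n => (x n : H) := by
      have h2 := hl.cauchySeq
      rw [Metric.cauchySeq_iff] at h2 ⊢
      intro ε hε
      obtain ⟨N, hN⟩ := h2 ε hε
      exact ⟨N, fun m hm n hn => (hdist m n).trans_lt (hN m hm n hn)⟩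
    obtain ⟨p, hp⟩ := cauchySeq_tendsto_of_complete hc
    have hAx : Filter.Tendsto (fun n => A (x n)) Filter.atTop (nhds (l - p)) := by
      have h3 := hl.sub hp
      refine h3.congr fun n => ?_
      rw [← hx n]
      change A (x n) + (x n : H) - (x n : H) = A (x n)
      abel
    have hg : (p, l - p) ∈ A.graph :=
      hA.isSelfAdjoint.isClosed.mem_of_tendsto (hp.prodMk_nhds hAx)
        (Filter.Eventually.of_forall fun n => A.mem_graph (x n))
    obtain ⟨q, hq1, hq2⟩ := (LinearPMap.mem_graph_iff A).1 hg
    refine ⟨q, ?_⟩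
    change A q + (q : H) = l
    simp only at hq1 hq2
    rw [hq2, hq1]
    abel
  have htop : LinearMap.range S = ⊤ := by
    have : CompleteSpace (LinearMap.range S) := hclosed.completeSpace_coe
    rw [← Submodule.orthogonal_eq_bot_iff, Submodule.eq_bot_iff]
    intro v hv
    have hv' : ∀ x : A.domain, ⟪-v, (x : H)⟫_ℂ = ⟪v, A x⟫_ℂ := by
      intro x
      have h := (Submodule.mem_orthogonal' _ _).1 hv (S x) ⟨x, rfl⟩
      change ⟪v, A x + (x : H)⟫_ℂ = 0 at h
      rw [inner_add_right] at h
      rw [inner_neg_left]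
      linear_combination -h
    have hmem : v ∈ A.adjoint.domain := LinearPMap.mem_adjoint_domain_of_exists v ⟨-v, hv'⟩
    have hval := LinearPMap.adjoint_apply_eq hA.isSelfAdjoint.dense_domain ⟨v, hmem⟩ hv'
    have hgr : (v, -v) ∈ A.graph := by
      rw [← show A.adjoint = A from hA.isSelfAdjoint]
      exact (LinearPMap.mem_graph_iff _).2 ⟨⟨v, hmem⟩, rfl, hval⟩
    obtain ⟨q, hq1, hq2⟩ := (LinearPMap.mem_graph_iff A).1 hgr
    simp only at hq1 hq2
    have h := hA.norm_le q
    rw [hq2, hq1, neg_add_cancel, norm_zero] at h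
    exact norm_le_zero_iff.1 h
  have : y ∈ LinearMap.range S := htop ▸ Submodule.mem_top
  exact this

theorem add_injective (hA : IsPositiveNondegenerate A) {x x' : A.domain}
    (h : A x + x = A x' + (x' : H)) : x = x' := by
  have h1 := hA.norm_le (x - x')
  have h2 : A (x - x') + ((x - x' : A.domain) : H) = 0 := by
    rw [LinearPMap.map_sub, AddSubgroupClass.coe_sub, sub_add_sub_comm, h, sub_self]
  rw [h2, norm_zero] at h1
  exact sub_eq_zero.1 (Subtype.ext (norm_le_zero_iff.1 h1))

/-- `(1 + A)⁻¹ y`, as an element of `D(A)`. -/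
noncomputable def solve (hA : IsPositiveNondegenerate A) (y : H) : A.domain :=
  (hA.exists_add_eq y).choose

theorem solve_spec (hA : IsPositiveNondegenerate A) (y : H) :
    A (hA.solve y) + (hA.solve y : H) = y :=
  (hA.exists_add_eq y).choose_spec

/-- The bounded operator `(1 + A)⁻¹`. -/
noncomputable def resolvent (hA : IsPositiveNondegenerate A) : H →L[ℂ] H :=
  LinearMap.mkContinuous
    { toFun := fun y => (hA.solve y : H)
      map_add' := fun y y' => by
        rw [← Submodule.coe_add]
        refine congrArg _ (hA.add_injective ?_)
        rw [hA.solve_spec, LinearPMap.map_add, Submodule.coe_add, add_add_add_comm,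
          hA.solve_spec, hA.solve_spec]
      map_smul' := fun c y => by
        rw [RingHom.id_apply, ← Submodule.coe_smul]
        refine congrArg _ (hA.add_injective ?_)
        rw [hA.solve_spec, LinearPMap.map_smul, Submodule.coe_smul, ← smul_add, hA.solve_spec] }
    1 (fun y => by
      rw [one_mul]
      exact (hA.norm_le (hA.solve y)).trans_eq (by rw [hA.solve_spec]))

theorem resolvent_apply (hA : IsPositiveNondegenerate A) (y : H) :
    hA.resolvent y = (hA.solve y : H) := rfl

theorem isPositive_resolvent (hA : IsPositiveNondegenerate A) : hA.resolvent.IsPositive := by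
  rw [ContinuousLinearMap.isPositive_def']
  refine ⟨?_, fun y => ?_⟩
  · rw [ContinuousLinearMap.isSelfAdjoint_iff_isSymmetric]
    intro y y'
    change ⟪(hA.solve y : H), y'⟫_ℂ = ⟪y, (hA.solve y' : H)⟫_ℂ
    conv_lhs => rw [← hA.solve_spec y']
    conv_rhs => rw [← hA.solve_spec y]
    rw [inner_add_left, inner_add_right, hA.symmetric]
  · rw [ContinuousLinearMap.reApplyInnerSelf_apply]
    have h := hA.norm_sq_le (hA.solve y)
    rw [hA.solve_spec] at h
    have h2 : RCLike.re ⟪hA.resolvent y, y⟫_ℂ = (⟪(hA.solve y : H), y⟫_ℂ).re := rfl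
    rw [h2]
    exact (sq_nonneg _).trans h

theorem isSelfAdjoint_resolvent (hA : IsPositiveNondegenerate A) :
    IsSelfAdjoint hA.resolvent :=
  hA.isPositive_resolvent.isSelfAdjoint

open scoped ComplexOrder in
/-- The spectrum of `(1 + A)⁻¹` lies in `[0, 1]`. -/
theorem spectrum_resolvent (hA : IsPositiveNondegenerate A) {w : ℂ}
    (hw : w ∈ spectrum ℂ hA.resolvent) : w = (w.re : ℂ) ∧ w.re ∈ Set.Icc (0 : ℝ) 1 := by
  have h1 : w = (w.re : ℂ) := hA.isSelfAdjoint_resolvent.mem_spectrum_eq_re hw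
  have h0 : (0 : H →L[ℂ] H) ≤ hA.resolvent :=
    (ContinuousLinearMap.nonneg_iff_isPositive _).2 hA.isPositive_resolvent
  have h2 : (0 : ℂ) ≤ w := spectrum_nonneg_of_nonneg h0 hw
  refine ⟨h1, (Complex.le_def.1 h2).1, ?_⟩
  have hn : ‖hA.resolvent‖ ≤ 1 := LinearMap.mkContinuous_norm_le _ zero_le_one _
  have hle : ‖w‖ ≤ ‖hA.resolvent‖ * ‖(1 : H →L[ℂ] H)‖ := spectrum.norm_le_norm_mul_of_mem hw
  have hone : ‖(1 : H →L[ℂ] H)‖ ≤ 1 := ContinuousLinearMap.norm_id_le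
  calc w.re ≤ ‖w‖ := Complex.re_le_norm w
    _ ≤ ‖hA.resolvent‖ * ‖(1 : H →L[ℂ] H)‖ := hle
    _ ≤ 1 * 1 := mul_le_mul hn hone (norm_nonneg _) zero_le_one
    _ = 1 := one_mul 1

/-- An integer larger than `|Re z|`. -/
noncomputable def order (z : ℂ) : ℕ := ⌊|z.re|⌋₊ + 1

/-- In the variable `r = (1 + l)⁻¹ ∈ [0, 1]`, where `l = (1 - r) / r`, the function
`(l / (1 + l)²) ^ n * l ^ z` with `n = order z > |Re z|`. It is continuous on `[0, 1]`, with
value `0` at both ends. -/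
noncomputable def regularizedPow (z : ℂ) (r : ℝ) : ℂ :=
  ((r * (1 - r) : ℝ) : ℂ) ^ order z * (((1 - r) / r : ℝ) : ℂ) ^ z

/-- The bounded operator `(A (1 + A)⁻²) ^ n`, `n = order z`, as a polynomial in `(1 + A)⁻¹`. -/
noncomputable def regularizer (hA : IsPositiveNondegenerate A) (z : ℂ) : H →L[ℂ] H :=
  (hA.resolvent * (1 - hA.resolvent)) ^ order z

/-- The complex power `A ^ z` of a positive non-degenerate operator, by the functional calculus
of `A`. Put `e(l) = (l / (1 + l)²) ^ n` with `n > |Re z|`. Then `e(l)` and `e(l) * l ^ z` are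
continuous functions of `(1 + l)⁻¹ ∈ [0, 1]`, so that `e(A)` and `(e * l ^ z)(A)` are bounded
operators, given by the continuous functional calculus of the bounded self-adjoint operator
`(1 + A)⁻¹`; the operator `e(A)` is injective, and `A ^ z = e(A)⁻¹ (e * l ^ z)(A)` on the natural
domain `{x | (e * l ^ z)(A) x ∈ Ran e(A)}`. This is the operator `∫ l ^ z dE(l)` for the
spectral measure `E` of `A`. -/
noncomputable def cpow (hA : IsPositiveNondegenerate A) (z : ℂ) : H →ₗ.[ℂ] H :=
  precomp ((hA.regularizer z : H →ₗ[ℂ] H).toPMap ⊤).inverse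
    (cfc (fun w : ℂ => regularizedPow z w.re) hA.resolvent : H →L[ℂ] H)

theorem norm_regularizedPow (z : ℂ) {r : ℝ} (hr : r ∈ Set.Icc (0 : ℝ) 1) :
    ‖regularizedPow z r‖ = r ^ ((order z : ℝ) - z.re) * (1 - r) ^ ((order z : ℝ) + z.re) := by
  have hn : |z.re| < (order z : ℝ) := by
    rw [order]
    push_cast
    exact Nat.lt_floor_add_one _
  obtain ⟨hn1, hn2⟩ := abs_lt.1 hn
  have hne : order z ≠ 0 := Nat.succ_ne_zero _
  rcases eq_or_lt_of_le hr.1 with h0 | h0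
  · subst h0
    simp [regularizedPow, hne, Real.zero_rpow (by linarith : (order z : ℝ) - z.re ≠ 0)]
  rcases eq_or_lt_of_le hr.2 with h1 | h1
  · subst h1
    simp [regularizedPow, hne, Real.zero_rpow (by linarith : (order z : ℝ) + z.re ≠ 0)]
  have h2 : 0 < 1 - r := by linarith
  rw [regularizedPow, norm_mul, norm_pow, Complex.norm_real,
    Complex.norm_cpow_eq_rpow_re_of_pos (by positivity), Real.norm_of_nonneg (by positivity),
    Real.div_rpow h2.le h0.le, Real.rpow_sub h0, Real.rpow_add h2, Real.rpow_natCast,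
    Real.rpow_natCast, mul_pow]
  have := (Real.rpow_pos_of_pos h0 z.re).ne'
  field_simp

theorem continuousOn_regularizedPow (z : ℂ) :
    ContinuousOn (regularizedPow z) (Set.Icc 0 1) := by
  have hn : |z.re| < (order z : ℝ) := by
    rw [order]
    push_cast
    exact Nat.lt_floor_add_one _
  obtain ⟨hn1, hn2⟩ := abs_lt.1 hn
  have hbound : Continuous fun r : ℝ =>
      r ^ ((order z : ℝ) - z.re) * (1 - r) ^ ((order z : ℝ) + z.re) :=
    (Real.continuous_rpow_const (by linarith)).mul
      ((Real.continuous_rpow_const (by linarith)).comp (continuous_const.sub continuous_id))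
  have hend : ∀ r ∈ Set.Icc (0 : ℝ) 1, ‖regularizedPow z r‖ = 0 →
      ContinuousWithinAt (regularizedPow z) (Set.Icc 0 1) r := by
    intro r hr hr0
    have hb := (hbound.continuousWithinAt (s := Set.Icc 0 1) (x := r)).tendsto
    rw [← norm_regularizedPow z hr, hr0] at hb
    rw [ContinuousWithinAt, norm_eq_zero.1 hr0]
    refine squeeze_zero_norm' ?_ hb
    exact eventually_nhdsWithin_of_forall fun s hs => (norm_regularizedPow z hs).le
  intro r hr
  rcases eq_or_lt_of_le hr.1 with h0 | h0
  · refine hend r hr ?_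
    rw [norm_regularizedPow z hr, ← h0, Real.zero_rpow (by linarith), zero_mul]
  rcases eq_or_lt_of_le hr.2 with h1 | h1
  · refine hend r hr ?_
    rw [norm_regularizedPow z hr, h1, sub_self, Real.zero_rpow (by linarith), mul_zero]
  have h2 : 0 < 1 - r := by linarith
  have hq : ContinuousAt (fun s : ℝ => (((1 - s) / s : ℝ) : ℂ)) r :=
    Complex.continuous_ofReal.continuousAt.comp
      (ContinuousAt.div (by fun_prop) continuousAt_id h0.ne')
  have hp : ContinuousAt (fun s : ℝ => ((s * (1 - s) : ℝ) : ℂ) ^ order z) r := by fun_prop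
  have hc : ContinuousAt (fun s : ℝ => (((1 - s) / s : ℝ) : ℂ) ^ z) r :=
    hq.cpow continuousAt_const (Or.inl (by rw [Complex.ofReal_re]; positivity))
  exact (hp.mul hc).continuousWithinAt

theorem continuousOn_spectrum (hA : IsPositiveNondegenerate A) (z : ℂ) :
    ContinuousOn (fun w : ℂ => regularizedPow z w.re) (spectrum ℂ hA.resolvent) :=
  (continuousOn_regularizedPow z).comp Complex.continuous_re.continuousOn
    fun _ hw => (hA.spectrum_resolvent hw).2

theorem regularizer_injective (hA : IsPositiveNondegenerate A) (z : ℂ) :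
    Function.Injective (hA.regularizer z) := by
  have h1 : Function.Injective hA.resolvent := by
    rw [injective_iff_map_eq_zero]
    intro y hy
    have h0 : hA.solve y = 0 := Subtype.ext hy
    rw [← hA.solve_spec y, h0]
    simp
  have h2 : Function.Injective (1 - hA.resolvent : H →L[ℂ] H) := by
    rw [injective_iff_map_eq_zero]
    intro y hy
    have h3 : y - (hA.solve y : H) = 0 := hy
    have h4 : A (hA.solve y) = 0 := by
      rw [← h3]
      exact eq_sub_of_add_eq (hA.solve_spec y)
    have h5 := hA.injective _ h4
    rwa [h5, sub_zero] at h3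
  have h3 : Function.Injective (hA.resolvent * (1 - hA.resolvent) : H →L[ℂ] H) := h1.comp h2
  rw [regularizer, FunLike.coe_pow_eq_iterate]
  exact h3.iterate _

/-- `y = A ^ z x` if and only if `e(A) y = (e * l ^ z)(A) x`. -/
theorem mem_graph_cpow_iff (hA : IsPositiveNondegenerate A) (z : ℂ) (x y : H) :
    (x, y) ∈ (hA.cpow z).graph ↔
      hA.regularizer z y =
        (cfc (fun w : ℂ => regularizedPow z w.re) hA.resolvent : H →L[ℂ] H) x := by
  have hker : LinearMap.ker ((hA.regularizer z : H →ₗ[ℂ] H).toPMap ⊤).toFun = ⊥ := by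
    rw [LinearMap.ker_eq_bot]
    intro a b hab
    exact Subtype.ext (hA.regularizer_injective z hab)
  rw [cpow, mem_graph_precomp_iff, LinearPMap.inverse_graph hker]
  simp only [Submodule.mem_map, LinearPMap.mem_graph_iff, Prod.exists]
  constructor
  · rintro ⟨a, b, ⟨w, hw1, hw2⟩, h⟩
    obtain ⟨h1, h2⟩ := Prod.mk.inj h
    simp only at h1 h2 hw1 hw2
    rw [← h2, ← hw1]
    exact hw2.trans h1
  · intro h
    exact ⟨y, _, ⟨⟨y, Submodule.mem_top⟩, rfl, h⟩, rfl⟩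

end IsPositiveNondegenerate

end UnboundedPower

/-! Everything is reduced to bounded operators. Write `R = (1 + A)⁻¹`, `l = (1 - r) / r`, `P = R (1
- R)`, and `e` for the regularizing function, so that `A ^ z` is the relation `e(A) y = (e l ^ z)(A)
x` between `x` and `y`.

The imaginary powers determine the resolvent (`comp_resolvent`). Integrating `l ^ (it)` against
Gaussian kernels in `t` produces Gaussians `g` in `log l`, and `T` intertwines the operators `g(A)`
and `g(B)` up to the factors `P`. Moving the centre of the Gaussian by `2b` multiplies it by a
constant times `l`, so `(1 + l) g` is again a combination of Gaussians. Comparing the relations for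
`g` and for `(1 + l) g` shows that `T` intertwines the resolvents on the range of `g(A)`. Widening
the Gaussian extends this to the range of `P`, which is dense.

By Weierstrass approximation, `T` then intertwines all continuous functions of the resolvents
(`comp_resolventCfc`). Hence the graph of `T A ^ z` lies in that of `B ^ z T`, which is closed.
Conversely, `(e + ε)⁻¹ e`, applied in `H` and in `K`, carries a point of the larger graph into the
smaller one and tends strongly to the identity as `ε → 0`
(`topologicalClosure_graph_compPMap_cpow`). -/

namespace UnboundedPower

namespace IsPositiveNondegenerate

/-! ### Continuous functions of the resolvent -/

section FunctionalCalculus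

variable {H : Type*} [NormedAddCommGroup H] [InnerProductSpace ℂ H] [CompleteSpace H]
  {A : H →ₗ.[ℂ] H}

/-- The operator `f((1 + A)⁻¹)` for a function `f` of a real variable that is continuous on
`[0, 1]`. -/
noncomputable def resolventCfc (hA : IsPositiveNondegenerate A) (f : ℝ → ℂ) : H →L[ℂ] H :=
  cfc (fun w : ℂ => f w.re) hA.resolvent

theorem continuousOn_comp_re (hA : IsPositiveNondegenerate A) {f : ℝ → ℂ}
    (hf : ContinuousOn f (Set.Icc 0 1)) :
    ContinuousOn (fun w : ℂ => f w.re) (spectrum ℂ hA.resolvent) :=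
  hf.comp Complex.continuous_re.continuousOn fun _ hw => (hA.spectrum_resolvent hw).2

theorem isStarNormal_resolvent (hA : IsPositiveNondegenerate A) : IsStarNormal hA.resolvent :=
  hA.isSelfAdjoint_resolvent.isStarNormal

theorem resolventCfc_congr (hA : IsPositiveNondegenerate A) {f g : ℝ → ℂ}
    (h : Set.EqOn f g (Set.Icc 0 1)) : hA.resolventCfc f = hA.resolventCfc g :=
  cfc_congr fun _ hw => h (hA.spectrum_resolvent hw).2

theorem resolventCfc_mul (hA : IsPositiveNondegenerate A) {f g : ℝ → ℂ}
    (hf : ContinuousOn f (Set.Icc 0 1)) (hg : ContinuousOn g (Set.Icc 0 1)) :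
    hA.resolventCfc (fun r => f r * g r) = hA.resolventCfc f * hA.resolventCfc g :=
  cfc_mul _ _ _ (hA.continuousOn_comp_re hf) (hA.continuousOn_comp_re hg)

theorem resolventCfc_sub (hA : IsPositiveNondegenerate A) {f g : ℝ → ℂ}
    (hf : ContinuousOn f (Set.Icc 0 1)) (hg : ContinuousOn g (Set.Icc 0 1)) :
    hA.resolventCfc (fun r => f r - g r) = hA.resolventCfc f - hA.resolventCfc g :=
  cfc_sub _ _ _ (hA.continuousOn_comp_re hf) (hA.continuousOn_comp_re hg)

theorem resolventCfc_add (hA : IsPositiveNondegenerate A) {f g : ℝ → ℂ}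
    (hf : ContinuousOn f (Set.Icc 0 1)) (hg : ContinuousOn g (Set.Icc 0 1)) :
    hA.resolventCfc (fun r => f r + g r) = hA.resolventCfc f + hA.resolventCfc g :=
  cfc_add _ _ _ (hA.continuousOn_comp_re hf) (hA.continuousOn_comp_re hg)

theorem resolventCfc_const_mul (hA : IsPositiveNondegenerate A) (c : ℂ) {f : ℝ → ℂ}
    (hf : ContinuousOn f (Set.Icc 0 1)) :
    hA.resolventCfc (fun r => c * f r) = c • hA.resolventCfc f :=
  cfc_const_mul c _ _ (hA.continuousOn_comp_re hf)

theorem resolventCfc_aeval (hA : IsPositiveNondegenerate A) (p : Polynomial ℂ) :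
    hA.resolventCfc (fun r => p.eval (r : ℂ)) = Polynomial.aeval hA.resolvent p := by
  rw [← cfc_polynomial p hA.resolvent hA.isStarNormal_resolvent]
  exact cfc_congr fun w hw => by simp only [← (hA.spectrum_resolvent hw).1]

theorem resolventCfc_id (hA : IsPositiveNondegenerate A) :
    hA.resolventCfc (fun r => (r : ℂ)) = hA.resolvent := by
  simpa using hA.resolventCfc_aeval Polynomial.X

theorem resolventCfc_mul_one_sub (hA : IsPositiveNondegenerate A) :
    hA.resolventCfc (fun r => ((r * (1 - r) : ℝ) : ℂ)) =
      hA.resolvent * (1 - hA.resolvent) := by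
  have h := hA.resolventCfc_aeval (Polynomial.X * (1 - Polynomial.X))
  simp only [Polynomial.eval_mul, Polynomial.eval_sub, Polynomial.eval_one, Polynomial.eval_X,
    map_mul, map_sub, map_one, Polynomial.aeval_X] at h
  rw [← h]
  push_cast
  rfl

theorem resolventCfc_mul_one_sub_pow (hA : IsPositiveNondegenerate A) (z : ℂ) :
    hA.resolventCfc (fun r => (((r * (1 - r)) ^ order z : ℝ) : ℂ)) = hA.regularizer z := by
  have h := hA.resolventCfc_aeval ((Polynomial.X * (1 - Polynomial.X)) ^ order z)
  simp only [Polynomial.eval_pow, Polynomial.eval_mul, Polynomial.eval_sub, Polynomial.eval_one,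
    Polynomial.eval_X, map_pow, map_mul, map_sub, map_one, Polynomial.aeval_X] at h
  rw [regularizer, ← h]
  push_cast
  rfl

theorem norm_resolventCfc_le (hA : IsPositiveNondegenerate A) {f : ℝ → ℂ} {c : ℝ} (hc : 0 ≤ c)
    (h : ∀ r ∈ Set.Icc (0 : ℝ) 1, ‖f r‖ ≤ c) : ‖hA.resolventCfc f‖ ≤ c :=
  norm_cfc_le hc fun _ hw => h _ (hA.spectrum_resolvent hw).2

theorem resolventCfc_commute (hA : IsPositiveNondegenerate A) {f g : ℝ → ℂ}
    (hf : ContinuousOn f (Set.Icc 0 1)) (hg : ContinuousOn g (Set.Icc 0 1)) :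
    hA.resolventCfc f * hA.resolventCfc g = hA.resolventCfc g * hA.resolventCfc f := by
  rw [← hA.resolventCfc_mul hf hg, ← hA.resolventCfc_mul hg hf]
  simp only [mul_comm]

/-- The operator is self-adjoint and injective, so the orthogonal complement of its range is its
kernel, which is zero. -/
theorem denseRange_regularizer (hA : IsPositiveNondegenerate A) (z : ℂ) :
    DenseRange (hA.regularizer z) := by
  have hsa : IsSelfAdjoint (hA.regularizer z) := by
    have h1 : IsSelfAdjoint (1 - hA.resolvent : H →L[ℂ] H) :=
      (IsSelfAdjoint.one _).sub hA.isSelfAdjoint_resolvent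
    refine IsSelfAdjoint.pow ?_ _
    refine (hA.isSelfAdjoint_resolvent.commute_iff h1).1 ?_
    exact (Commute.one_right _).sub_right (Commute.refl _)
  have hker : (hA.regularizer z).ker = ⊥ := LinearMap.ker_eq_bot.2 (hA.regularizer_injective z)
  have horth : (hA.regularizer z).rangeᗮ = ⊥ := by
    rw [ContinuousLinearMap.orthogonal_range, hsa.adjoint_eq, hker]
  have := Submodule.dense_iff_topologicalClosure_eq_top.2
    ((Submodule.topologicalClosure_eq_top_iff).2 horth)
  exact this

end FunctionalCalculus

/-! ### From the resolvents to their continuous functions -/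

section Intertwining

variable {H : Type*} [NormedAddCommGroup H] [InnerProductSpace ℂ H] [CompleteSpace H]
  {K : Type*} [NormedAddCommGroup K] [InnerProductSpace ℂ K] [CompleteSpace K]
  {A : H →ₗ.[ℂ] H} {B : K →ₗ.[ℂ] K}

theorem _root_.exists_complex_polynomial_near_of_continuousOn {f : ℝ → ℂ} {a b : ℝ}
    (hf : ContinuousOn f (Set.Icc a b)) {ε : ℝ} (hε : 0 < ε) :
    ∃ p : Polynomial ℂ, ∀ r ∈ Set.Icc a b, ‖p.eval (r : ℂ) - f r‖ ≤ ε := by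
  obtain ⟨p, hp⟩ := exists_polynomial_near_of_continuousOn a b (fun r => (f r).re)
    (Complex.continuous_re.comp_continuousOn hf) (ε / 2) (by positivity)
  obtain ⟨q, hq⟩ := exists_polynomial_near_of_continuousOn a b (fun r => (f r).im)
    (Complex.continuous_im.comp_continuousOn hf) (ε / 2) (by positivity)
  refine ⟨p.map Complex.ofRealHom + Polynomial.C Complex.I * q.map Complex.ofRealHom,
    fun r hr => ?_⟩
  have h1 : ∀ s : Polynomial ℝ, (s.map Complex.ofRealHom).eval (r : ℂ) = (s.eval r : ℝ) :=
    fun s => Polynomial.eval_map_apply Complex.ofRealHom r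
  refine (Complex.norm_le_abs_re_add_abs_im _).trans ?_
  have h2 := hp r hr
  have h3 := hq r hr
  simp only [Polynomial.eval_add, Polynomial.eval_mul, Polynomial.eval_C, h1, Complex.sub_re,
    Complex.sub_im, Complex.add_re, Complex.add_im, Complex.mul_re, Complex.mul_im,
    Complex.ofReal_re, Complex.ofReal_im, Complex.I_re, Complex.I_im]
  simp only [zero_mul, mul_zero, one_mul, sub_zero, add_zero, zero_add]
  linarith

/-- An operator that intertwines the resolvents intertwines their continuous functions. -/
theorem comp_resolventCfc (hA : IsPositiveNondegenerate A) (hB : IsPositiveNondegenerate B)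
    {T : H →L[ℂ] K} (hT : T ∘L hA.resolvent = hB.resolvent ∘L T) {f : ℝ → ℂ}
    (hf : ContinuousOn f (Set.Icc 0 1)) :
    T ∘L hA.resolventCfc f = hB.resolventCfc f ∘L T := by
  have hpoly : ∀ p : Polynomial ℂ,
      T ∘L Polynomial.aeval hA.resolvent p = Polynomial.aeval hB.resolvent p ∘L T := by
    intro p
    induction p using Polynomial.induction_on' with
    | add p q hp hq => rw [map_add, map_add, ContinuousLinearMap.comp_add, hp, hq,
        ContinuousLinearMap.add_comp]
    | monomial n c =>
      have hpow : T ∘L (hA.resolvent ^ n) = (hB.resolvent ^ n) ∘L T := by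
        induction n with
        | zero => ext x; simp
        | succ n ih =>
          ext x
          have h1 := DFunLike.congr_fun ih (hA.resolvent x)
          have h2 := DFunLike.congr_fun hT x
          simp only [ContinuousLinearMap.comp_apply] at h1 h2
          simp only [pow_succ, ContinuousLinearMap.comp_apply, mul_apply_eq_comp]
          rw [h1, h2]
      rw [Polynomial.aeval_monomial, Polynomial.aeval_monomial, ← Algebra.smul_def,
        ← Algebra.smul_def, ContinuousLinearMap.comp_smul, hpow, ContinuousLinearMap.smul_comp]
  rw [← sub_eq_zero, ← norm_le_zero_iff]
  refine le_of_forall_pos_le_add fun ε hε => ?_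
  rw [zero_add]
  -- Two approximation errors of size `‖T‖ * δ` must fit in `ε`; the `+ 1` covers `T = 0`.
  set δ : ℝ := ε / (2 * (‖T‖ + 1)) with hδ
  have hδ0 : 0 < δ := by positivity
  obtain ⟨p, hp⟩ := exists_complex_polynomial_near_of_continuousOn hf hδ0
  have hpc : ContinuousOn (fun r : ℝ => p.eval (r : ℂ)) (Set.Icc 0 1) :=
    (p.continuous.comp Complex.continuous_ofReal).continuousOn
  have h1 : ‖hA.resolventCfc f - Polynomial.aeval hA.resolvent p‖ ≤ δ := by
    rw [← hA.resolventCfc_aeval, ← hA.resolventCfc_sub hf hpc]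
    exact hA.norm_resolventCfc_le hδ0.le fun r hr => (norm_sub_rev _ _).trans_le (hp r hr)
  have h2 : ‖hB.resolventCfc f - Polynomial.aeval hB.resolvent p‖ ≤ δ := by
    rw [← hB.resolventCfc_aeval, ← hB.resolventCfc_sub hf hpc]
    exact hB.norm_resolventCfc_le hδ0.le fun r hr => (norm_sub_rev _ _).trans_le (hp r hr)
  have h3 : T ∘L hA.resolventCfc f - hB.resolventCfc f ∘L T =
      T ∘L (hA.resolventCfc f - Polynomial.aeval hA.resolvent p) -
        (hB.resolventCfc f - Polynomial.aeval hB.resolvent p) ∘L T := by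
    rw [ContinuousLinearMap.comp_sub, ContinuousLinearMap.sub_comp, hpoly p]
    abel
  rw [h3]
  calc _ ≤ ‖T‖ * δ + δ * ‖T‖ := (norm_sub_le _ _).trans (add_le_add
        ((ContinuousLinearMap.opNorm_comp_le _ _).trans (by gcongr))
        ((ContinuousLinearMap.opNorm_comp_le _ _).trans (by gcongr)))
    _ ≤ ε := by
      have : (2 * (‖T‖ + 1)) * δ = ε := by rw [hδ]; field_simp
      nlinarith [norm_nonneg T]

end Intertwining

end IsPositiveNondegenerate
end UnboundedPower

/-! ### Scalar functions of `r`: continuity at the endpoints and Gaussian estimates -/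

/-- At a zero of `β` the product is squeezed by `‖β‖`. With `β = r (1 - r)` this handles the
endpoints, where `log l` is singular. -/
theorem continuousOn_mul_of_norm_le_one {X : Type*} [TopologicalSpace X] {s : Set X} {β h : X → ℂ}
    (hβ : ContinuousOn β s) (h1 : ∀ x ∈ s, ‖h x‖ ≤ 1)
    (hc : ∀ x ∈ s, β x ≠ 0 → ContinuousWithinAt h s x) :
    ContinuousOn (fun x => β x * h x) s := by
  intro x hx
  by_cases h0 : β x = 0
  · have hb := (hβ x hx).norm.tendsto
    rw [h0, norm_zero] at hb
    rw [ContinuousWithinAt, h0, zero_mul]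
    refine squeeze_zero_norm' (eventually_nhdsWithin_of_forall fun y hy => ?_) hb
    rw [norm_mul]
    exact mul_le_of_le_one_right (norm_nonneg _) (h1 y hy)
  · exact (hβ x hx).mul (hc x hx h0)

namespace UnboundedPower

open IsPositiveNondegenerate

theorem pos_of_mul_one_sub_ne_zero {r : ℝ} (hr : r ∈ Set.Icc (0 : ℝ) 1)
    (h : ((r * (1 - r) : ℝ) : ℂ) ≠ 0) : 0 < r ∧ 0 < 1 - r := by
  have h1 : r * (1 - r) ≠ 0 := by exact_mod_cast h
  exact ⟨lt_of_le_of_ne hr.1 (left_ne_zero_of_mul h1).symm,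
    lt_of_le_of_ne (by linarith [hr.2]) (right_ne_zero_of_mul h1).symm⟩

/-- All imaginary powers share the regularizer `R (1 - R)`, so it can stay outside an integral over
`t`. -/
theorem order_ofReal_mul_I (t : ℝ) : order (t * Complex.I) = 1 := by
  simp [order]

theorem regularizedPow_ofReal_mul_I (t : ℝ) {r : ℝ} (hr : r ∈ Set.Icc (0 : ℝ) 1) :
    regularizedPow (t * Complex.I) r = ((r * (1 - r) : ℝ) : ℂ) *
      Complex.exp (Complex.I * (Real.log ((1 - r) / r) : ℝ) * t) := by
  rw [regularizedPow, order_ofReal_mul_I, pow_one]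
  by_cases h : ((r * (1 - r) : ℝ) : ℂ) = 0
  · rw [h, zero_mul, zero_mul]
  obtain ⟨h0, h1⟩ := pos_of_mul_one_sub_ne_zero hr h
  have h2 : 0 < (1 - r) / r := div_pos h1 h0
  rw [Complex.cpow_def_of_ne_zero (by exact_mod_cast h2.ne'), Complex.ofReal_log h2.le]
  congr 2
  ring

theorem continuousOn_regularizedPow_ofReal_mul_I :
    ContinuousOn (fun q : ℝ × ℝ => regularizedPow (q.1 * Complex.I) q.2)
      (Set.univ ×ˢ Set.Icc 0 1) := by
  refine ContinuousOn.congr (f := fun q : ℝ × ℝ => ((q.2 * (1 - q.2) : ℝ) : ℂ) *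
    Complex.exp (Complex.I * (Real.log ((1 - q.2) / q.2) : ℝ) * q.1)) ?_
    fun q hq => regularizedPow_ofReal_mul_I q.1 hq.2
  refine continuousOn_mul_of_norm_le_one (by fun_prop) (fun q _ => ?_) fun q hq h => ?_
  · rw [Complex.norm_exp]
    simp
  · obtain ⟨h0, h1⟩ := pos_of_mul_one_sub_ne_zero hq.2 h
    have hd : ContinuousAt (fun q : ℝ × ℝ => (1 - q.2) / q.2) q :=
      ContinuousAt.div (by fun_prop) (by fun_prop) h0.ne'
    have hl : ContinuousAt (fun q : ℝ × ℝ => (Real.log ((1 - q.2) / q.2) : ℝ)) q :=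
      hd.log (div_pos h1 h0).ne'
    exact ContinuousAt.continuousWithinAt (by fun_prop)

/-- In the variable `r = (1 + l)⁻¹ ∈ [0, 1]`, the function
`l / (1 + l)² * exp (-(log l - m)² / (4 b))`. -/
noncomputable def gaussianWeight (b m : ℝ) (r : ℝ) : ℂ :=
  ((r * (1 - r) : ℝ) : ℂ) * ((Real.exp (-(Real.log ((1 - r) / r) - m) ^ 2 / (4 * b)) : ℝ) : ℂ)

theorem continuousOn_gaussianWeight {b : ℝ} (hb : 0 < b) (m : ℝ) :
    ContinuousOn (gaussianWeight b m) (Set.Icc 0 1) := by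
  refine continuousOn_mul_of_norm_le_one (by fun_prop) (fun r _ => ?_) fun r hr h => ?_
  · rw [Complex.norm_real, Real.norm_of_nonneg (Real.exp_pos _).le, Real.exp_le_one_iff]
    exact div_nonpos_of_nonpos_of_nonneg (neg_nonpos.2 (sq_nonneg _)) (by positivity)
  · obtain ⟨h0, h1⟩ := pos_of_mul_one_sub_ne_zero hr h
    have hd : ContinuousAt (fun r : ℝ => (1 - r) / r) r :=
      ContinuousAt.div (by fun_prop) (by fun_prop) h0.ne'
    have hl : ContinuousAt (fun r : ℝ => (Real.log ((1 - r) / r) : ℝ)) r :=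
      hd.log (div_pos h1 h0).ne'
    exact ContinuousAt.continuousWithinAt (by fun_prop)

/-- Shifting the Gaussian by `2 b` multiplies it by a multiple of `l = (1 - r) / r`. -/
theorem mul_gaussianWeight_add {b : ℝ} (hb : 0 < b) {r : ℝ} (hr : r ∈ Set.Icc (0 : ℝ) 1) :
    (r : ℂ) * (gaussianWeight b 0 r + (Real.exp b : ℝ) * gaussianWeight b (2 * b) r) =
      gaussianWeight b 0 r := by
  by_cases h : ((r * (1 - r) : ℝ) : ℂ) = 0
  · simp only [gaussianWeight, h, zero_mul, mul_zero, add_zero]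
  obtain ⟨h0, h1⟩ := pos_of_mul_one_sub_ne_zero hr h
  set s := Real.log ((1 - r) / r) with hs
  -- Completing the square: `b - (s - 2b)² / (4b) = s - s² / (4b)`, and `exp s = l`.
  have hexp : Real.exp b * Real.exp (-(s - 2 * b) ^ 2 / (4 * b)) =
      (1 - r) / r * Real.exp (-(s - 0) ^ 2 / (4 * b)) := by
    rw [← Real.exp_log (div_pos h1 h0), ← hs, ← Real.exp_add, ← Real.exp_add]
    congr 1
    field_simp
    ring
  simp only [gaussianWeight, ← hs]
  norm_cast
  calc _ = r * (r * (1 - r)) * (Real.exp (-(s - 0) ^ 2 / (4 * b)) +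
        Real.exp b * Real.exp (-(s - 2 * b) ^ 2 / (4 * b))) := by ring
    _ = _ := by
      rw [hexp]
      field_simp
      ring

/-- With `s = log l`, the bound `s² ≤ 2 (exp s + exp (-s))` is multiplied by `r (1 - r)`, which
turns the bracket into `(1 - r)² + r² ≤ 1`. -/
theorem mul_one_sub_mul_log_sq_le {r : ℝ} (hr : r ∈ Set.Icc (0 : ℝ) 1) :
    r * (1 - r) * Real.log ((1 - r) / r) ^ 2 ≤ 2 := by
  by_cases h : ((r * (1 - r) : ℝ) : ℂ) = 0
  · rw [Complex.ofReal_eq_zero.1 h, zero_mul]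
    exact zero_le_two
  obtain ⟨h0, h1⟩ := pos_of_mul_one_sub_ne_zero hr h
  set s := Real.log ((1 - r) / r) with hs
  have h2 : Real.exp s = (1 - r) / r := Real.exp_log (div_pos h1 h0)
  have h3 : Real.exp (-s) = r / (1 - r) := by rw [Real.exp_neg, h2, inv_div]
  have h4 : s ^ 2 ≤ 2 * (Real.exp s + Real.exp (-s)) := by
    have h5 : Real.exp |s| ≤ Real.exp s + Real.exp (-s) := by
      rcases abs_choice s with h | h <;> rw [h] <;>
        linarith [Real.exp_pos s, Real.exp_pos (-s)]
    have h6 := Real.quadratic_le_exp_of_nonneg (abs_nonneg s)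
    rw [sq_abs] at h6
    linarith [abs_nonneg s]
  calc _ ≤ r * (1 - r) * (2 * (Real.exp s + Real.exp (-s))) := by
        have : 0 < r * (1 - r) := mul_pos h0 h1
        gcongr
    _ = 2 * ((1 - r) ^ 2 + r ^ 2) := by rw [h2, h3]; field_simp
    _ ≤ 2 := by nlinarith [mul_pos h0 h1]

/-- From `1 - exp (-u) ≤ u` with `u = s² / (4b)`; the factor `r (1 - r)` absorbs `s²`, so wide
Gaussians converge uniformly on `[0, 1]`. -/
theorem norm_mul_one_sub_sub_gaussianWeight_le {b : ℝ} (hb : 0 < b) {r : ℝ}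
    (hr : r ∈ Set.Icc (0 : ℝ) 1) :
    ‖((r * (1 - r) : ℝ) : ℂ) - gaussianWeight b 0 r‖ ≤ 1 / (2 * b) := by
  have h0 : 0 ≤ r * (1 - r) := mul_nonneg hr.1 (by linarith [hr.2])
  set s := Real.log ((1 - r) / r) with hs
  have h1 : gaussianWeight b 0 r =
      ((r * (1 - r) * Real.exp (-(s ^ 2 / (4 * b))) : ℝ) : ℂ) := by
    rw [gaussianWeight, ← hs, sub_zero, neg_div, Complex.ofReal_mul (r * (1 - r))]
  have h2 : Real.exp (-(s ^ 2 / (4 * b))) ≤ 1 :=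
    Real.exp_le_one_iff.2 (neg_nonpos.2 (by positivity))
  have h3 := Real.add_one_le_exp (-(s ^ 2 / (4 * b)))
  rw [h1, ← Complex.ofReal_sub, Complex.norm_real, Real.norm_of_nonneg (by nlinarith)]
  calc _ = r * (1 - r) * (1 - Real.exp (-(s ^ 2 / (4 * b)))) := by ring
    _ ≤ r * (1 - r) * (s ^ 2 / (4 * b)) := by gcongr; linarith
    _ = (r * (1 - r) * s ^ 2) / (4 * b) := by ring
    _ ≤ 2 / (4 * b) := by gcongr; exact mul_one_sub_mul_log_sq_le hr
    _ = 1 / (2 * b) := by field_simp; norm_num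

namespace IsPositiveNondegenerate

/-! ### Gaussian averages of the imaginary powers -/

section

variable {H : Type*} [NormedAddCommGroup H] [InnerProductSpace ℂ H] [CompleteSpace H]
  {A : H →ₗ.[ℂ] H}

/-- The kernel whose Fourier transform is a Gaussian centred at `m`. -/
noncomputable def gaussianKernel (b m : ℝ) (t : ℝ) : ℂ :=
  Complex.exp (-(Complex.I * m * t)) * Complex.exp (-(b : ℂ) * t ^ 2)

theorem norm_gaussianKernel (b m t : ℝ) : ‖gaussianKernel b m t‖ = Real.exp (-b * t ^ 2) := by
  have h : (-(b : ℂ) * t ^ 2) = ((-b * t ^ 2 : ℝ) : ℂ) := by push_cast; ring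
  rw [gaussianKernel, norm_mul, h, Complex.norm_exp, Complex.norm_exp, Complex.ofReal_re]
  simp

theorem norm_regularizedPow_ofReal_mul_I_le (t : ℝ) {r : ℝ} (hr : r ∈ Set.Icc (0 : ℝ) 1) :
    ‖regularizedPow (t * Complex.I) r‖ ≤ 1 := by
  rw [norm_regularizedPow _ hr, order_ofReal_mul_I]
  simp only [Nat.cast_one, Complex.mul_re, Complex.ofReal_re, Complex.I_re, mul_zero,
    Complex.ofReal_im, zero_mul, sub_zero, add_zero, Real.rpow_one]
  nlinarith [hr.1, hr.2]

theorem continuousOn_gaussianKernel_mul (hA : IsPositiveNondegenerate A) (b m : ℝ) :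
    ContinuousOn (Function.uncurry fun (t : ℝ) (w : ℂ) =>
      gaussianKernel b m t * regularizedPow (t * Complex.I) w.re)
      (Set.univ ×ˢ spectrum ℂ hA.resolvent) := by
  refine ContinuousOn.mul ?_ ?_
  · unfold gaussianKernel
    fun_prop
  · exact continuousOn_regularizedPow_ofReal_mul_I.comp
      (f := fun q : ℝ × ℂ => (q.1, q.2.re)) (by fun_prop)
      fun q hq => ⟨Set.mem_univ _, (hA.spectrum_resolvent hq.2).2⟩

theorem norm_gaussianKernel_mul_le (hA : IsPositiveNondegenerate A) (b m : ℝ) (t : ℝ) {w : ℂ}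
    (hw : w ∈ spectrum ℂ hA.resolvent) :
    ‖gaussianKernel b m t * regularizedPow (t * Complex.I) w.re‖ ≤ Real.exp (-b * t ^ 2) := by
  rw [norm_mul, norm_gaussianKernel]
  exact mul_le_of_le_one_right (Real.exp_pos _).le
    (norm_regularizedPow_ofReal_mul_I_le t (hA.spectrum_resolvent hw).2)

theorem integrable_gaussianKernel_smul (hA : IsPositiveNondegenerate A) {b : ℝ} (hb : 0 < b)
    (m : ℝ) :
    MeasureTheory.Integrable fun t : ℝ =>
      gaussianKernel b m t • hA.resolventCfc (regularizedPow (t * Complex.I)) := by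
  have h := integrable_cfc (μ := MeasureTheory.volume) (fun (t : ℝ) (w : ℂ) =>
    gaussianKernel b m t * regularizedPow (t * Complex.I) w.re)
    (fun t => Real.exp (-b * t ^ 2)) hA.resolvent (hA.continuousOn_gaussianKernel_mul b m)
    (.of_forall fun t _ hw => hA.norm_gaussianKernel_mul_le b m t hw)
    (integrable_exp_neg_mul_sq hb).hasFiniteIntegral hA.isStarNormal_resolvent
  refine h.congr (.of_forall fun t => ?_)
  exact hA.resolventCfc_const_mul _ (continuousOn_regularizedPow _)

/-- The functional calculus commutes with the integral, which leaves at each spectral point the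
Fourier transform of a Gaussian at `log l - m`. -/
theorem integral_gaussianKernel_smul (hA : IsPositiveNondegenerate A) {b : ℝ} (hb : 0 < b)
    (m : ℝ) :
    ∫ t : ℝ, gaussianKernel b m t • hA.resolventCfc (regularizedPow (t * Complex.I)) =
      ((Real.pi / b : ℂ) ^ (1 / 2 : ℂ)) • hA.resolventCfc (gaussianWeight b m) := by
  have h := cfc_integral (μ := MeasureTheory.volume) (fun (t : ℝ) (w : ℂ) =>
    gaussianKernel b m t * regularizedPow (t * Complex.I) w.re)
    (fun t => Real.exp (-b * t ^ 2)) hA.resolvent (hA.continuousOn_gaussianKernel_mul b m)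
    (.of_forall fun t _ hw => hA.norm_gaussianKernel_mul_le b m t hw)
    (integrable_exp_neg_mul_sq hb).hasFiniteIntegral hA.isStarNormal_resolvent
  rw [← hA.resolventCfc_const_mul _ (continuousOn_gaussianWeight hb m)]
  calc _ = ∫ t : ℝ, cfc (fun w : ℂ => gaussianKernel b m t *
        regularizedPow (t * Complex.I) w.re) hA.resolvent := by
        congr 1
        ext1 t
        exact (hA.resolventCfc_const_mul _ (continuousOn_regularizedPow _)).symm
    _ = _ := by
      rw [← h]
      refine cfc_congr fun w hw => ?_
      have hr := (hA.spectrum_resolvent hw).2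
      generalize w.re = r at hr
      set s := Real.log ((1 - r) / r) with hs
      have h1 := fourierIntegral_gaussian (b := b) (by simpa using hb) ((s : ℂ) - m)
      simp only
      rw [gaussianWeight, ← hs]
      calc _ = ∫ t : ℝ, ((r * (1 - r) : ℝ) : ℂ) * (Complex.exp (Complex.I * (s - m) * t) *
            Complex.exp (-(b : ℂ) * t ^ 2)) := by
            congr 1
            ext1 t
            have h2 : Complex.exp (Complex.I * (s - m) * t) =
                Complex.exp (Complex.I * s * t) * Complex.exp (-(Complex.I * m * t)) := by
              rw [← Complex.exp_add]
              congr 1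
              ring
            rw [regularizedPow_ofReal_mul_I t hr, gaussianKernel, ← hs, h2]
            ring
        _ = _ := by
          rw [MeasureTheory.integral_const_mul, h1]
          push_cast
          ring

end

/-! ### The imaginary powers determine the resolvent -/

section Intertwining

variable {H : Type*} [NormedAddCommGroup H] [InnerProductSpace ℂ H] [CompleteSpace H]
  {K : Type*} [NormedAddCommGroup K] [InnerProductSpace ℂ K] [CompleteSpace K]
  {A : H →ₗ.[ℂ] H} {B : K →ₗ.[ℂ] K}

/-- The vectors `e(A) w` lie in the domain of `A ^ z`, with image `(e l ^ z)(A) w`. Evaluating the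
hypothesis on them gives an identity between bounded operators. -/
theorem comp_resolventCfc_regularizedPow (hA : IsPositiveNondegenerate A)
    (hB : IsPositiveNondegenerate B) {T : H →L[ℂ] K} {z : ℂ}
    (hT : (T : H →ₗ[ℂ] K).compPMap (hA.cpow z) = precomp (hB.cpow z) (T : H →ₗ[ℂ] K)) :
    hB.regularizer z ∘L T ∘L hA.resolventCfc (regularizedPow z) =
      hB.resolventCfc (regularizedPow z) ∘L T ∘L hA.regularizer z := by
  ext w
  have hc : hA.regularizer z (hA.resolventCfc (regularizedPow z) w) =
      hA.resolventCfc (regularizedPow z) (hA.regularizer z w) := by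
    rw [← hA.resolventCfc_mul_one_sub_pow]
    exact DFunLike.congr_fun (hA.resolventCfc_commute (by fun_prop)
      (continuousOn_regularizedPow z)) w
  have h1 : (hA.regularizer z w, hA.resolventCfc (regularizedPow z) w) ∈ (hA.cpow z).graph :=
    (hA.mem_graph_cpow_iff z _ _).2 hc
  obtain ⟨x, hx1, hx2⟩ := (LinearPMap.mem_graph_iff _).1 h1
  have h2 : (hA.regularizer z w, T (hA.resolventCfc (regularizedPow z) w)) ∈
      ((T : H →ₗ[ℂ] K).compPMap (hA.cpow z)).graph :=
    (LinearPMap.mem_graph_iff _).2 ⟨x, hx1, congrArg T hx2⟩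
  rw [hT, mem_graph_precomp_iff, mem_graph_cpow_iff] at h2
  exact h2

/-- Both sides of the hypothesis are bounded linear in the functions of `A` and `B`, so they can be
integrated against the Gaussian kernel; the common nonzero constant cancels. -/
theorem comp_resolventCfc_gaussianWeight (hA : IsPositiveNondegenerate A)
    (hB : IsPositiveNondegenerate B) {T : H →L[ℂ] K} {b : ℝ} (hb : 0 < b) (m : ℝ)
    (hT : ∀ t : ℝ, (hB.resolvent * (1 - hB.resolvent)) ∘L T ∘L
        hA.resolventCfc (regularizedPow (t * Complex.I)) =
      hB.resolventCfc (regularizedPow (t * Complex.I)) ∘L T ∘L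
        (hA.resolvent * (1 - hA.resolvent))) :
    (hB.resolvent * (1 - hB.resolvent)) ∘L T ∘L hA.resolventCfc (gaussianWeight b m) =
      hB.resolventCfc (gaussianWeight b m) ∘L T ∘L (hA.resolvent * (1 - hA.resolvent)) := by
  set P := hA.resolvent * (1 - hA.resolvent)
  set Q := hB.resolvent * (1 - hB.resolvent)
  have hc : ((Real.pi / b : ℂ) ^ (1 / 2 : ℂ)) ≠ 0 := by
    rw [Complex.cpow_ne_zero_iff]
    left
    exact_mod_cast (div_pos Real.pi_pos hb).ne'
  let L₁ : (H →L[ℂ] H) →L[ℂ] (H →L[ℂ] K) := ContinuousLinearMap.compL ℂ H H K (Q ∘L T)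
  let L₂ : (K →L[ℂ] K) →L[ℂ] (H →L[ℂ] K) := (ContinuousLinearMap.compL ℂ H K K).flip (T ∘L P)
  have h1 := L₁.integral_comp_comm (hA.integrable_gaussianKernel_smul hb m)
  have h2 := L₂.integral_comp_comm (hB.integrable_gaussianKernel_smul hb m)
  rw [integral_gaussianKernel_smul _ hb, map_smul] at h1 h2
  refine smul_right_injective _ hc ?_
  change _ • L₁ _ = _ • L₂ _
  rw [← h1, ← h2]
  congr 1
  ext1 t
  rw [map_smul, map_smul]
  exact congrArg _ (hT t)

theorem comp_resolvent (hA : IsPositiveNondegenerate A)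
    (hB : IsPositiveNondegenerate B) {T : H →L[ℂ] K}
    (hT : ∀ t : ℝ, (T : H →ₗ[ℂ] K).compPMap (hA.cpow (t * Complex.I)) =
      precomp (hB.cpow (t * Complex.I)) (T : H →ₗ[ℂ] K)) :
    T ∘L hA.resolvent = hB.resolvent ∘L T := by
  have hreg : ∀ (t : ℝ), hA.regularizer (t * Complex.I) = hA.resolvent * (1 - hA.resolvent) ∧
      hB.regularizer (t * Complex.I) = hB.resolvent * (1 - hB.resolvent) := fun t => by
    simp only [regularizer, order_ofReal_mul_I, pow_one, and_self]
  have hw : ∀ {b : ℝ}, 0 < b → ∀ m : ℝ, _ := fun hb m =>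
    hA.comp_resolventCfc_gaussianWeight hB (T := T) hb m fun t => by
      rw [← (hreg t).1, ← (hreg t).2]
      exact hA.comp_resolventCfc_regularizedPow hB (hT t)
  -- The value `t = 0` serves only to read off that `Q` is injective and `P` has dense range.
  have hinj := hB.regularizer_injective ((0 : ℝ) * Complex.I)
  have hdense := hA.denseRange_regularizer ((0 : ℝ) * Complex.I)
  rw [(hreg 0).2] at hinj
  rw [(hreg 0).1] at hdense
  set P := hA.resolvent * (1 - hA.resolvent) with hP
  set Q := hB.resolvent * (1 - hB.resolvent) with hQ
  set D : H →L[ℂ] K := T ∘L hA.resolvent - hB.resolvent ∘L T with hD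
  have hzero : ∀ b : ℝ, 0 < b → D ∘L hA.resolventCfc (gaussianWeight b 0) = 0 := by
    intro b hb
    -- For `0 < r < 1` this is `(1 + l)` times the centred weight, so multiplying by `r = (1 + l)⁻¹`
    -- returns that weight.
    set f : ℝ → ℂ := fun r => gaussianWeight b 0 r + (Real.exp b : ℝ) * gaussianWeight b (2 * b) r
      with hf
    have hc0 := continuousOn_gaussianWeight hb 0
    have hc1 := continuousOn_gaussianWeight hb (2 * b)
    have hc2 : ContinuousOn (fun r => ((Real.exp b : ℝ) : ℂ) * gaussianWeight b (2 * b) r)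
      (Set.Icc 0 1) := continuousOn_const.mul hc1
    have hcf : ContinuousOn f (Set.Icc 0 1) := hc0.add hc2
    have hcid : ContinuousOn (fun r : ℝ => (r : ℂ)) (Set.Icc 0 1) := by fun_prop
    have hfT : Q ∘L T ∘L hA.resolventCfc f = hB.resolventCfc f ∘L T ∘L P := by
      rw [hf, resolventCfc_add _ hc0 hc2, resolventCfc_add _ hc0 hc2,
        resolventCfc_const_mul _ _ hc1, resolventCfc_const_mul _ _ hc1]
      simp only [ContinuousLinearMap.comp_add, ContinuousLinearMap.add_comp,
        ContinuousLinearMap.comp_smul, ContinuousLinearMap.smul_comp]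
      rw [hw hb 0, hw hb (2 * b)]
    have hFA : hA.resolventCfc (gaussianWeight b 0) = hA.resolvent * hA.resolventCfc f := by
      conv_rhs => rw [← hA.resolventCfc_id, ← hA.resolventCfc_mul hcid hcf]
      exact hA.resolventCfc_congr fun r hr => (mul_gaussianWeight_add hb hr).symm
    have hFA' : hA.resolventCfc (gaussianWeight b 0) = hA.resolventCfc f * hA.resolvent := by
      rw [hFA]
      conv_lhs => rw [← hA.resolventCfc_id, hA.resolventCfc_commute hcid hcf, hA.resolventCfc_id]
    have hFB : hB.resolventCfc (gaussianWeight b 0) = hB.resolvent * hB.resolventCfc f := by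
      conv_rhs => rw [← hB.resolventCfc_id, ← hB.resolventCfc_mul hcid hcf]
      exact hB.resolventCfc_congr fun r hr => (mul_gaussianWeight_add hb hr).symm
    have hQR : ∀ y, Q (hB.resolvent y) = hB.resolvent (Q y) := by
      intro y
      have : Q * hB.resolvent = hB.resolvent * Q := by rw [hQ]; noncomm_ring
      exact DFunLike.congr_fun this y
    have hDf : ∀ x, D (hA.resolventCfc f x) = 0 := by
      intro x
      -- `Q T R f(A) = R f(B) T P = R Q T f(A) = Q R T f(A)`, with `R` the resolvent of `A` or of
      -- `B` as the place requires.
      refine hinj ?_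
      have h1 := DFunLike.congr_fun (hw hb 0) x
      have h2 := DFunLike.congr_fun hfT x
      rw [hFA, hFB] at h1
      simp only [ContinuousLinearMap.comp_apply, mul_apply_eq_comp] at h1 h2
      rw [hD, map_zero, sub_apply, map_sub]
      simp only [ContinuousLinearMap.comp_apply]
      rw [hQR, h1, h2, sub_self]
    ext x
    rw [hFA']
    exact hDf _
  have hDP : D ∘L P = 0 := by
    rw [← norm_le_zero_iff]
    refine le_of_forall_pos_le_add fun ε hε => ?_
    rw [zero_add]
    -- Makes the error `‖D‖ / (2b)` at most `ε`.
    set b : ℝ := (‖D‖ + 1) / ε with hb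
    have hb0 : 0 < b := by positivity
    have h1 : ‖P - hA.resolventCfc (gaussianWeight b 0)‖ ≤ 1 / (2 * b) := by
      rw [hP, ← resolventCfc_mul_one_sub,
        ← hA.resolventCfc_sub (by fun_prop) (continuousOn_gaussianWeight hb0 0)]
      exact hA.norm_resolventCfc_le (by positivity)
        fun r hr => norm_mul_one_sub_sub_gaussianWeight_le hb0 hr
    have h2 : D ∘L P = D ∘L (P - hA.resolventCfc (gaussianWeight b 0)) := by
      rw [ContinuousLinearMap.comp_sub, hzero b hb0, sub_zero]
    rw [h2]
    calc _ ≤ ‖D‖ * (1 / (2 * b)) := (ContinuousLinearMap.opNorm_comp_le _ _).trans (by gcongr)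
      _ ≤ ε := by
        rw [hb]
        field_simp
        nlinarith [norm_nonneg D]
  have hD0 : (D : H → K) = (0 : H →L[ℂ] K) :=
    hdense.equalizer D.continuous (0 : H →L[ℂ] K).continuous
      (funext fun x => DFunLike.congr_fun hDP x)
  exact sub_eq_zero.1 (DFunLike.coe_injective hD0)

end Intertwining

end IsPositiveNondegenerate
end UnboundedPower
namespace UnboundedPower

namespace IsPositiveNondegenerate

/-! ### An approximate identity built from the regularizer -/

section

variable {H : Type*} [NormedAddCommGroup H] [InnerProductSpace ℂ H] [CompleteSpace H]
  {A : H →ₗ.[ℂ] H}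

/-- In the variable `r = (1 + l)⁻¹ ∈ [0, 1]`, with `e(l) = (l / (1 + l)²) ^ n` and `n = order z`,
the function `(e(l) + ε)⁻¹`. -/
noncomputable def cutoffInv (z : ℂ) (ε : ℝ) (r : ℝ) : ℂ :=
  ((((r * (1 - r)) ^ order z + ε)⁻¹ : ℝ) : ℂ)

theorem mul_one_sub_pow_nonneg (z : ℂ) {r : ℝ} (hr : r ∈ Set.Icc (0 : ℝ) 1) :
    0 ≤ (r * (1 - r)) ^ order z :=
  pow_nonneg (mul_nonneg hr.1 (sub_nonneg.2 hr.2)) _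

theorem continuousOn_cutoffInv (z : ℂ) {ε : ℝ} (hε : 0 < ε) :
    ContinuousOn (cutoffInv z ε) (Set.Icc 0 1) := by
  refine Complex.continuous_ofReal.comp_continuousOn (ContinuousOn.inv₀ (by fun_prop) ?_)
  exact fun r hr => (add_pos_of_nonneg_of_pos (mul_one_sub_pow_nonneg z hr) hε).ne'

theorem norm_cutoffInv_mul_le (hA : IsPositiveNondegenerate A) (z : ℂ) {ε : ℝ} (hε : 0 < ε) :
    ‖hA.resolventCfc (cutoffInv z ε) * hA.regularizer z‖ ≤ 1 := by
  rw [← resolventCfc_mul_one_sub_pow,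
    ← hA.resolventCfc_mul (continuousOn_cutoffInv z hε) (by fun_prop)]
  refine hA.norm_resolventCfc_le zero_le_one fun r hr => ?_
  have h0 := mul_one_sub_pow_nonneg z hr
  rw [cutoffInv, ← Complex.ofReal_mul, Complex.norm_real, Real.norm_of_nonneg (by positivity),
    inv_mul_le_one₀ (by positivity)]
  linarith

/-- Pointwise the difference is `e² / (e + ε) - e = -ε e / (e + ε)`. -/
theorem norm_cutoffInv_mul_mul_sub_le (hA : IsPositiveNondegenerate A) (z : ℂ) {ε : ℝ}
    (hε : 0 < ε) :
    ‖hA.resolventCfc (cutoffInv z ε) * hA.regularizer z * hA.regularizer z -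
      hA.regularizer z‖ ≤ ε := by
  have hc := continuousOn_cutoffInv z hε
  have hp : ContinuousOn (fun r : ℝ => (((r * (1 - r)) ^ order z : ℝ) : ℂ)) (Set.Icc 0 1) := by
    fun_prop
  have hcp : ContinuousOn (fun r => cutoffInv z ε r * (((r * (1 - r)) ^ order z : ℝ) : ℂ))
    (Set.Icc 0 1) := hc.mul hp
  have hcpp : ContinuousOn (fun r => cutoffInv z ε r * (((r * (1 - r)) ^ order z : ℝ) : ℂ) *
    (((r * (1 - r)) ^ order z : ℝ) : ℂ)) (Set.Icc 0 1) := hcp.mul hp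
  rw [← resolventCfc_mul_one_sub_pow, ← hA.resolventCfc_mul hc hp,
    ← hA.resolventCfc_mul hcp hp, ← hA.resolventCfc_sub hcpp hp]
  refine hA.norm_resolventCfc_le hε.le fun r hr => ?_
  have h0 := mul_one_sub_pow_nonneg z hr
  rw [cutoffInv]
  generalize (r * (1 - r)) ^ order z = e at h0
  have h1 : (e + ε)⁻¹ * e * e - e = -(ε * ((e + ε)⁻¹ * e)) := by
    field_simp
    ring
  rw [← Complex.ofReal_mul, ← Complex.ofReal_mul, ← Complex.ofReal_sub, Complex.norm_real, h1,
    norm_neg, Real.norm_of_nonneg (by positivity)]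
  refine mul_le_of_le_one_right hε.le ?_
  rw [inv_mul_le_one₀ (by positivity)]
  linarith

/-- The operators `(e(A) + ε)⁻¹ e(A)` converge strongly to `1` as `ε → 0`. -/
theorem tendsto_cutoffInv_mul (hA : IsPositiveNondegenerate A) (z : ℂ) (x : H) :
    Filter.Tendsto
      (fun ε : ℝ => (hA.resolventCfc (cutoffInv z ε) * hA.regularizer z) x)
      (nhdsWithin 0 (Set.Ioi 0)) (nhds x) := by
  rw [Metric.tendsto_nhds]
  intro δ hδ
  -- On the range of `e(A)` the error is at most `ε * ‖w‖ < δ / 2`; the remainder `x - e(A) w`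
  -- enters twice, since the operators are contractions.
  obtain ⟨w, hw⟩ := (hA.denseRange_regularizer z).exists_dist_lt x (by positivity : 0 < δ / 4)
  have hlt : ∀ᶠ ε : ℝ in nhdsWithin 0 (Set.Ioi 0), ε * ‖w‖ < δ / 2 := by
    have h : Filter.Tendsto (fun ε : ℝ => ε * ‖w‖) (nhdsWithin 0 (Set.Ioi 0)) (nhds (0 * ‖w‖)) :=
      (Filter.tendsto_id.mono_left nhdsWithin_le_nhds).mul_const _
    rw [zero_mul] at h
    exact h.eventually_lt_const (by positivity)
  filter_upwards [hlt, self_mem_nhdsWithin] with ε h1 hε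
  have hε : 0 < ε := hε
  set G := hA.resolventCfc (cutoffInv z ε) * hA.regularizer z with hG
  have hn : ‖G‖ ≤ 1 := hA.norm_cutoffInv_mul_le z hε
  rw [dist_eq_norm] at hw ⊢
  have h2 : G x - x = G (x - hA.regularizer z w) - (x - hA.regularizer z w) +
      (G * hA.regularizer z - hA.regularizer z) w := by
    rw [sub_apply, mul_apply_eq_comp G, map_sub]
    abel
  have h3 : ‖G (x - hA.regularizer z w)‖ ≤ ‖x - hA.regularizer z w‖ := by
    simpa using G.le_of_opNorm_le hn (x - hA.regularizer z w)
  have h4 : ‖(G * hA.regularizer z - hA.regularizer z) w‖ ≤ ε * ‖w‖ :=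
    ContinuousLinearMap.le_of_opNorm_le _ (hA.norm_cutoffInv_mul_mul_sub_le z hε) w
  rw [h2]
  have h5 := norm_add_le (G (x - hA.regularizer z w) - (x - hA.regularizer z w))
    ((G * hA.regularizer z - hA.regularizer z) w)
  have h6 := norm_sub_le (G (x - hA.regularizer z w)) (x - hA.regularizer z w)
  linarith

end

/-! ### The closure of the graph -/

section Intertwining

variable {H : Type*} [NormedAddCommGroup H] [InnerProductSpace ℂ H] [CompleteSpace H]
  {K : Type*} [NormedAddCommGroup K] [InnerProductSpace ℂ K] [CompleteSpace K]
  {A : H →ₗ.[ℂ] H} {B : K →ₗ.[ℂ] K}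

theorem topologicalClosure_graph_compPMap_cpow (hA : IsPositiveNondegenerate A)
    (hB : IsPositiveNondegenerate B) {T : H →L[ℂ] K}
    (hT : T ∘L hA.resolvent = hB.resolvent ∘L T) (z : ℂ) :
    ((T : H →ₗ[ℂ] K).compPMap (hA.cpow z)).graph.topologicalClosure =
      (precomp (hB.cpow z) (T : H →ₗ[ℂ] K)).graph := by
  have hp := continuousOn_regularizedPow z
  have hTe : ∀ x, T (hA.regularizer z x) = hB.regularizer z (T x) := by
    rw [← hA.resolventCfc_mul_one_sub_pow, ← hB.resolventCfc_mul_one_sub_pow]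
    exact fun x => DFunLike.congr_fun (hA.comp_resolventCfc hB hT (by fun_prop)) x
  have hTc : ∀ x, T (hA.resolventCfc (regularizedPow z) x) =
      hB.resolventCfc (regularizedPow z) (T x) :=
    fun x => DFunLike.congr_fun (hA.comp_resolventCfc hB hT hp) x
  have hmemA : ∀ x y, (x, y) ∈ (hA.cpow z).graph ↔
      hA.regularizer z y = hA.resolventCfc (regularizedPow z) x := hA.mem_graph_cpow_iff z
  have hmem : ∀ x y, (x, y) ∈ (precomp (hB.cpow z) (T : H →ₗ[ℂ] K)).graph ↔
      hB.regularizer z y = hB.resolventCfc (regularizedPow z) (T x) := fun x y =>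
    (mem_graph_precomp_iff _ _ _ _).trans (hB.mem_graph_cpow_iff z _ _)
  apply le_antisymm
  · refine Submodule.topologicalClosure_minimal _ ?_ ?_
    · rintro ⟨x, y⟩ hxy
      obtain ⟨w, rfl, rfl⟩ := (LinearPMap.mem_graph_iff _).1 hxy
      have h1 := (hmemA _ _).1 ((hA.cpow z).mem_graph w)
      refine (hmem _ _).2 ?_
      change hB.regularizer z (T (hA.cpow z w)) = _
      rw [← hTe, h1, hTc]
    -- The larger graph is the solution set of an equation between continuous maps, hence closed.
    · have h1 : ((precomp (hB.cpow z) (T : H →ₗ[ℂ] K)).graph : Set (H × K)) =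
          {q | hB.regularizer z q.2 = hB.resolventCfc (regularizedPow z) (T q.1)} :=
        Set.ext fun q => hmem q.1 q.2
      rw [h1]
      exact isClosed_eq (by fun_prop) (by fun_prop)
  · rintro ⟨x, y⟩ hxy
    have hxy' := (hmem x y).1 hxy
    refine mem_closure_of_tendsto
      ((hA.tendsto_cutoffInv_mul z x).prodMk_nhds (hB.tendsto_cutoffInv_mul z y)) ?_
    filter_upwards [self_mem_nhdsWithin] with ε hε
    have hk := continuousOn_cutoffInv z (Set.mem_Ioi.1 hε)
    set k := cutoffInv z ε
    have hcomm : ∀ {f g : ℝ → ℂ}, ContinuousOn f (Set.Icc 0 1) → ContinuousOn g (Set.Icc 0 1) →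
        ∀ v, hA.resolventCfc f (hA.resolventCfc g v) = hA.resolventCfc g (hA.resolventCfc f v) :=
      fun hf hg v => DFunLike.congr_fun (hA.resolventCfc_commute hf hg) v
    -- The factor `e` moves `x` into the domain of `A ^ z`, with `A ^ z (k e)(A) x = k(A) (e l ^
    -- z)(A) x`. Applying `T` gives `k(B) (e l ^ z)(B) T x`, which is `(k e)(B) y` by the equation
    -- for `(x, y)`.
    have h1 : ((hA.resolventCfc k * hA.regularizer z) x,
        hA.resolventCfc k (hA.resolventCfc (regularizedPow z) x)) ∈ (hA.cpow z).graph := by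
      rw [hmemA, ← resolventCfc_mul_one_sub_pow, mul_apply_eq_comp, hcomm (by fun_prop) hk,
        hcomm (by fun_prop) hp, hcomm hk hp]
    obtain ⟨w, hw1, hw2⟩ := (LinearPMap.mem_graph_iff _).1 h1
    refine (LinearPMap.mem_graph_iff _).2 ⟨w, hw1, ?_⟩
    have h2 : T (hA.resolventCfc k (hA.resolventCfc (regularizedPow z) x)) =
        hB.resolventCfc k (T (hA.resolventCfc (regularizedPow z) x)) :=
      DFunLike.congr_fun (hA.comp_resolventCfc hB hT hk) _
    change T (hA.cpow z w) = hB.resolventCfc k (hB.regularizer z y)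
    rw [hxy', ← hTc, ← h2]
    exact congrArg T hw2

end Intertwining

end IsPositiveNondegenerate
end UnboundedPower

theorem mainTheorem12 {H : Type u} {K : Type v}
    [NormedAddCommGroup H] [InnerProductSpace ℂ H] [CompleteSpace H]
    [NormedAddCommGroup K] [InnerProductSpace ℂ K] [CompleteSpace K]
    (ΔH : H →ₗ.[ℂ] H) (ΔK : K →ₗ.[ℂ] K)
    (hH : UnboundedPower.IsPositiveNondegenerate ΔH)
    (hK : UnboundedPower.IsPositiveNondegenerate ΔK)
    (T : H →L[ℂ] K)
    (hT : ∀ t : ℝ, (T : H →ₗ[ℂ] K).compPMap (hH.cpow (t * Complex.I)) =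
      UnboundedPower.precomp (hK.cpow (t * Complex.I)) (T : H →ₗ[ℂ] K))
    (z : ℂ) :
    ((T : H →ₗ[ℂ] K).compPMap (hH.cpow z)).IsClosable ∧
      ((T : H →ₗ[ℂ] K).compPMap (hH.cpow z)).closure =
        UnboundedPower.precomp (hK.cpow z) (T : H →ₗ[ℂ] K) := by
  have hgraph := hH.topologicalClosure_graph_compPMap_cpow hK (hH.comp_resolvent hK hT) z
  have hclosable : ((T : H →ₗ[ℂ] K).compPMap (hH.cpow z)).IsClosable := ⟨_, hgraph⟩
  exact ⟨hclosable, LinearPMap.eq_of_eq_graph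
    (hclosable.graph_closure_eq_closure_graph.symm.trans hgraph)⟩
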